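/- **Notation.** Let $n\ge 1$, let $S^{n-1}$ and $B^n$ be the unit sphere and the closed unit ball of $\mathbb{R}^n$, let $du$ be the spherical (surface area) measure on $S^{n-1}$, and let $\mathcal{K}_{(o)}^n$ be the set of compact convex subsets of $\mathbb{R}^n$ with the origin in their interior. For $K\in\mathcal{K}_{(o)}^n$ let $h_K(u)=\max_{x\in K}\langle x,u\rangle$ and $\rho_K(u)=\max\{\lambda\ge 0:\lambda u\in K\}$ ($u\in S^{n-1}$), and $K^\circ=\{x:\langle x,y\rangle\le 1\ \forall y\in K\}$. Let $\mathcal{G}_I$ be the set of continuous functions $G:(0,\infty)\times S^{n-1}\to(0,\infty)$ such that, for every $u\in S^{n-1}$, $G(\cdot,u)$ is strictly increasing, $\lim_{t\to0^+}G(t,u)=0$ and $\lim_{t\to\infty}G(t,u)=\infty$. For $G\in\mathcal{G}_I$ and $K\in\mathcal{K}_{(o)}^n$ put $$\widetilde V_G(K)=\int_{S^{n-1}}G(\rho_K(u),u)\,du,\qquad \widehat V_G(K)=\inf\Big\{\eta>0:\int_{S^{n-1}}G\Big(\frac{\rho_K(u)}{\eta},u\Big)du\le 1\Big\},$$ $$\widetilde{\mathcal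 B}=\{Q\in\mathcal{K}_{(o)}^n:\widetilde V_G(Q^\circ)=\widetilde V_G(B^n)\},\qquad \widehat{\mathcal B}=\{Q\in\mathcal{K}_{(o)}^n:\widehat V_G(Q^\circ)=\widehat V_G(B^n)\}.$$ Let $\mathcal{I}$ be the set of continuous strictly increasing functions $\varphi:(0,\infty)\to(0,\infty)$ with $\lim_{t\to0^+}\varphi(t)=0$, $\varphi(1)=1$ and $\lim_{t\to\infty}\varphi(t)=\infty$. **Theorem.** Let $\mu$ and $\mu_i$ ($i\in\mathbb{N}$) be finite Borel measures on $S^{n-1}$, none of them concentrated on a closed hemisphere, with $\mu_i\to\mu$ weakly. Let $\varphi\in\mathcal{I}$, and let $G\in\mathcal{G}_I$ be such that, for some real $q\ge n-1$, $$\inf\Big\{\frac{G(t,u)}{t^q}: t\ge 1,\ u\in S^{n-1}\Big\}>0.$$ i) If for each $i\in\mathbb{N}$ there is $\widetilde M_i\in\widetilde{\mathcal B}$ with $$\int_{S^{n-1}}\varphi(h_{\widetilde M_i})\,d\mu_i=\inf\Big\{\int_{S^{n-1}}\varphi(h_Q)\,d\mu_i: Q\in\widetilde{\mathcal B}\Big\},$$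 then there is $\widetilde M\in\widetilde{\mathcal B}$ with $$\int_{S^{n-1}}\varphi(h_{\widetilde M})\,d\mu=\inf\Big\{\int_{S^{n-1}}\varphi(h_Q)\,d\mu: Q\in\widetilde{\mathcal B}\Big\},\qquad\text{and}\qquad \lim_{i\to\infty}\int_{S^{n-1}}\varphi(h_{\widetilde M_i})\,d\mu_i=\int_{S^{n-1}}\varphi(h_{\widetilde M})\,d\mu.$$ ii) The same statement holds with $\widetilde{\mathcal B}$ replaced throughout by $\widehat{\mathcal B}$. -/

import Mathlib

open MeasureTheory Filter Topology Set

noncomputable section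

namespace DualPolar

/-- Euclidean space `ℝⁿ`. -/
abbrev E (n : ℕ) : Type := EuclideanSpace ℝ (Fin n)

/-- The unit sphere `S^{n-1}` of `ℝⁿ`, as a type. -/
abbrev Sph (n : ℕ) : Type := Metric.sphere (0 : E n) 1

/-- The spherical measure `du` on `S^{n-1}`, i.e. the surface area measure, with total mass
`n * vol (Bⁿ)` (for `n = 1`: counting measure on two points). -/
def sphereMeasure (n : ℕ) : Measure (Sph n) := (volume : Measure (E n)).toSphere

/-- The support function `h_K(u) = max {⟨x, u⟩ : x ∈ K}`. -/
def supportFn {n : ℕ} (K : Set (E n)) (u : Sph n) : ℝ :=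
  sSup ((fun x : E n => inner ℝ x (u : E n)) '' K)

/-- The radial function `ρ_K(u) = max {r ≥ 0 : r u ∈ K}`. -/
def radialFn {n : ℕ} (K : Set (E n)) (u : Sph n) : ℝ :=
  sSup {r : ℝ | 0 ≤ r ∧ r • (u : E n) ∈ K}

/-- The polar set `K° = {x : ⟨x, y⟩ ≤ 1 for all y ∈ K}`. -/
def polarSet {n : ℕ} (K : Set (E n)) : Set (E n) :=
  {x : E n | ∀ y ∈ K, inner ℝ x y ≤ 1}

/-- The unit Euclidean ball `Bⁿ`. -/
def unitBall (n : ℕ) : Set (E n) := Metric.closedBall (0 : E n) 1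

/-- The compact convex sets in `ℝⁿ` with the origin in their interiors. -/
def originInterior (n : ℕ) : Set (ConvexBody (E n)) :=
  {K | (0 : E n) ∈ interior (K : Set (E n))}

/-- The general dual volume `∫ G(ρ_K(u), u) du`. -/
def dualVolume {n : ℕ} (G : ℝ → Sph n → ℝ) (K : Set (E n)) : ℝ :=
  ∫ u : Sph n, G (radialFn K u) u ∂(sphereMeasure n)

/-- The homogeneous general dual volume
`inf {η > 0 : ∫ G(ρ_K(u)/η, u) du ≤ 1}` (for `G` increasing in the first variable). -/
def homDualVolume {n : ℕ} (G : ℝ → Sph n → ℝ) (K : Set (E n)) : ℝ :=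
  sInf {η : ℝ | 0 < η ∧ ∫ u : Sph n, G (radialFn K u / η) u ∂(sphereMeasure n) ≤ 1}

/-- The class of continuous functions `G : (0, ∞) × S^{n-1} → (0, ∞)` which are strictly
increasing in `t`, with limit `0` as `t → 0+` and limit `∞` as `t → ∞`, for each `u`.
Only the values of `G` on `(0, ∞) × S^{n-1}` matter. -/
structure ClassGI {n : ℕ} (G : ℝ → Sph n → ℝ) : Prop where
  continuousOn : ContinuousOn (fun p : ℝ × Sph n => G p.1 p.2) (Ioi 0 ×ˢ univ)
  pos : ∀ t : ℝ, 0 < t → ∀ u, 0 < G t u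
  strictMono : ∀ u, StrictMonoOn (fun t => G t u) (Ioi 0)
  tendsto_zero : ∀ u, Tendsto (fun t => G t u) (𝓝[>] 0) (𝓝 0)
  tendsto_top : ∀ u, Tendsto (fun t => G t u) atTop atTop

/-- The growth condition `inf {G(t, u) / t^q : t ≥ 1, u ∈ S^{n-1}} > 0`. -/
def GrowthCondition {n : ℕ} (G : ℝ → Sph n → ℝ) (q : ℝ) : Prop :=
  0 < sInf {x : ℝ | ∃ (t : ℝ) (u : Sph n), 1 ≤ t ∧ x = G t u / t ^ q}

/-- The class of continuous strictly increasing `φ : (0, ∞) → (0, ∞)` with `φ(0+) = 0`,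
`φ(1) = 1` and `φ(∞) = ∞`. Only the values of `φ` on `(0, ∞)` matter. -/
structure ClassI (φ : ℝ → ℝ) : Prop where
  continuousOn : ContinuousOn φ (Ioi 0)
  pos : ∀ t : ℝ, 0 < t → 0 < φ t
  strictMonoOn : StrictMonoOn φ (Ioi 0)
  tendsto_zero : Tendsto φ (𝓝[>] 0) (𝓝 0)
  map_one : φ 1 = 1
  tendsto_top : Tendsto φ atTop atTop

/-- `μ` is concentrated on some closed hemisphere `{u : 0 ≤ ⟨u, v⟩}` with `v ∈ S^{n-1}`. -/
def ConcentratedOnHemisphere {n : ℕ} (μ : FiniteMeasure (Sph n)) : Prop :=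
  ∃ v : Sph n, (μ : Measure (Sph n)) {u : Sph n | 0 ≤ inner ℝ (u : E n) (v : E n)}ᶜ = 0

/-- The constraint set `{Q : Ṽ_G(Q°) = Ṽ_G(Bⁿ)}`. -/
def constraintTilde {n : ℕ} (G : ℝ → Sph n → ℝ) : Set (ConvexBody (E n)) :=
  {Q | Q ∈ originInterior n ∧
    dualVolume G (polarSet (Q : Set (E n))) = dualVolume G (unitBall n)}

/-- The constraint set `{Q : V̂_G(Q°) = V̂_G(Bⁿ)}`. -/
def constraintHat {n : ℕ} (G : ℝ → Sph n → ℝ) : Set (ConvexBody (E n)) :=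
  {Q | Q ∈ originInterior n ∧
    homDualVolume G (polarSet (Q : Set (E n))) = homDualVolume G (unitBall n)}

/-- The objective functional `∫ φ(h_Q(u)) dμ(u)`. -/
def objective {n : ℕ} (φ : ℝ → ℝ) (μ : FiniteMeasure (Sph n)) (Q : ConvexBody (E n)) : ℝ :=
  ∫ u : Sph n, φ (supportFn (Q : Set (E n)) u) ∂(μ : Measure (Sph n))

/-- `M ∈ 𝓑` and `∫ φ(h_M) dμ = inf {∫ φ(h_Q) dμ : Q ∈ 𝓑}`. -/
def IsSolution {n : ℕ} (φ : ℝ → ℝ) (μ : FiniteMeasure (Sph n))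
    (B : Set (ConvexBody (E n))) (M : ConvexBody (E n)) : Prop :=
  M ∈ B ∧ objective φ μ M = sInf (objective φ μ '' B)

end DualPolar

end

open scoped ENNReal Pointwise

namespace DualPolar

variable {n : ℕ}

/-! Compactness and lower semicontinuity, with one critical estimate. Since `ρ_{Q°} = 1 / h_Q`, both
the constraint and the objective are integrals of the support function, which depends continuously
on the body in the sup norm.

The ball satisfies the constraint, so the objective at each minimizer is at most its value at the
ball. As `μ` charges every open hemisphere, this bounds the minimizers uniformly
(`exists_eventually_subset_closedBall`), and Blaschke selection gives a convergent subsequence.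

The danger is a limit `M₀` with the origin on its boundary. Then `h_{M₀}(v) ≤ 0` for some `v`, so
near `v` the function `h_{M₀}` is at most a multiple of the distance to the line through `v`. Growth
`t ^ q` with `q ≥ n - 1` makes the integral of `G (1 / h)` diverge, logarithmically in the
borderline case (`lintegral_liminf_eq_top`). By Fatou this contradicts the fixed dual volume. Hence
the constraint is closed along the sequence, and minimality passes to the limit. The limiting value
is the infimum for `μ`, the same for every subsequence, so the whole sequence of values converges.

The homogeneous problem is the first one for the rescaled function `G (t * s) u`
(`exists_constraintHat_eq_constraintTilde`). -/

/-! ### Support functions, polar bodies and the unit ball. -/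

lemma bddAbove_inner_image (K : ConvexBody (E n)) (u : Sph n) :
    BddAbove ((fun x : E n => inner ℝ x (u : E n)) '' (K : Set (E n))) :=
  (K.isCompact.image (by fun_prop)).bddAbove

lemma inner_le_supportFn {K : ConvexBody (E n)} {x : E n} (hx : x ∈ (K : Set (E n))) (u : Sph n) :
    inner ℝ x (u : E n) ≤ supportFn (K : Set (E n)) u :=
  le_csSup (bddAbove_inner_image K u) (mem_image_of_mem _ hx)

lemma supportFn_le {K : ConvexBody (E n)} {u : Sph n} {c : ℝ}
    (h : ∀ x ∈ (K : Set (E n)), inner ℝ x (u : E n) ≤ c) : supportFn (K : Set (E n)) u ≤ c :=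
  csSup_le (K.nonempty.image _) (by rintro _ ⟨x, hx, rfl⟩; exact h x hx)

lemma norm_sph (u : Sph n) : ‖(u : E n)‖ = 1 := by simp

lemma inner_le_norm_sph (x : E n) (u : Sph n) : inner ℝ x (u : E n) ≤ ‖x‖ := by
  simpa using real_inner_le_norm x (u : E n)

lemma supportFn_le_add_dist (K L : ConvexBody (E n)) (u : Sph n) :
    supportFn (K : Set (E n)) u ≤ supportFn (L : Set (E n)) u + dist K L := by
  refine supportFn_le fun x hx => ?_
  obtain ⟨y, hy, hxy⟩ := L.isCompact.exists_infDist_eq_dist L.nonempty x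
  have h1 : dist x y ≤ dist K L := by
    rw [← hxy]
    exact Metric.infDist_le_hausdorffDist_of_mem hx ConvexBody.hausdorffEDist_ne_top
  have h2 := inner_le_supportFn hy u
  have h3 := inner_le_norm_sph (x - y) u
  rw [inner_sub_left, ← dist_eq_norm] at h3
  linarith

lemma continuous_supportFn (K : ConvexBody (E n)) :
    Continuous (supportFn (K : Set (E n))) := by
  obtain ⟨R, hR, hK⟩ := K.isBounded.exists_pos_norm_le
  have key : ∀ u v : Sph n, supportFn (K : Set (E n)) u ≤
      supportFn (K : Set (E n)) v + R * dist u v := by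
    intro u v
    refine supportFn_le fun x hx => ?_
    have h1 := inner_le_supportFn hx v
    have h2 : inner ℝ x ((u : E n) - v) ≤ R * dist u v := by
      refine (real_inner_le_norm _ _).trans ?_
      rw [Subtype.dist_eq, dist_eq_norm]
      exact mul_le_mul_of_nonneg_right (hK x hx) (norm_nonneg _)
    rw [inner_sub_right] at h2
    linarith
  exact (LipschitzWith.of_le_add_mul ⟨R, hR.le⟩ key).continuous

/-- The support function as a continuous function on the sphere. -/
noncomputable def supportMap (K : ConvexBody (E n)) : C(Sph n, ℝ) :=
  ⟨supportFn (K : Set (E n)), continuous_supportFn K⟩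

@[simp] lemma supportMap_apply (K : ConvexBody (E n)) (u : Sph n) :
    supportMap K u = supportFn (K : Set (E n)) u := rfl

lemma continuous_supportMap : Continuous (supportMap : ConvexBody (E n) → C(Sph n, ℝ)) := by
  refine (LipschitzWith.mk_one fun K L => ?_).continuous
  refine (ContinuousMap.dist_le dist_nonneg).2 fun u => ?_
  rw [Real.dist_eq, abs_sub_le_iff]
  have h1 := supportFn_le_add_dist K L u
  have h2 := supportFn_le_add_dist L K u
  rw [dist_comm] at h2
  simp only [supportMap_apply]
  constructor <;> linarith

lemma supportFn_pos {K : ConvexBody (E n)} (hK : K ∈ originInterior n) (u : Sph n) :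
    0 < supportFn (K : Set (E n)) u := by
  obtain ⟨ε, hε, hb⟩ := Metric.mem_nhds_iff.1 (mem_interior_iff_mem_nhds.1 hK)
  have hmem : (ε / 2) • (u : E n) ∈ (K : Set (E n)) := by
    apply hb
    simp [norm_smul, abs_of_pos hε]
    linarith
  have := inner_le_supportFn hmem u
  rw [inner_smul_left, real_inner_self_eq_norm_sq] at this
  simp at this
  linarith

/-- By compactness the support function has a positive minimum `r` on the sphere. The ball of radius
`r` lies in `K`: a hyperplane separating a point `x` from `K` has a unit normal `u` with `h_K(u) <
‖x‖`. -/
lemma mem_originInterior_of_supportFn_pos (hn : 1 ≤ n) {K : ConvexBody (E n)}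
    (h : ∀ u, 0 < supportFn (K : Set (E n)) u) : K ∈ originInterior n := by
  have : Nonempty (Fin n) := ⟨⟨0, hn⟩⟩
  have : Nonempty (Sph n) := (NormedSpace.sphere_nonempty.2 zero_le_one).to_subtype
  obtain ⟨u₀, -, hu₀⟩ := isCompact_univ.exists_isMinOn univ_nonempty
    (continuous_supportFn K).continuousOn
  set r := supportFn (K : Set (E n)) u₀ with hr
  have hsub : Metric.ball (0 : E n) r ⊆ K := by
    intro x hx
    by_contra hxK
    obtain ⟨f, s, hf1, hf2⟩ := geometric_hahn_banach_closed_point K.convex K.isClosed hxK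
    obtain ⟨w, rfl⟩ := (InnerProductSpace.toDual ℝ (E n)).surjective f
    simp only [InnerProductSpace.toDual_apply_apply] at hf1 hf2
    have hw : w ≠ 0 := by
      rintro rfl
      obtain ⟨y, hy⟩ := K.nonempty
      have := hf1 y hy
      simp at this hf2
      linarith
    have hw' : 0 < ‖w‖ := norm_pos_iff.2 hw
    let u : Sph n := ⟨‖w‖⁻¹ • w, by simp [norm_smul, hw'.ne']⟩
    have h1 : supportFn (K : Set (E n)) u ≤ ‖w‖⁻¹ * s := by
      refine supportFn_le fun y hy => ?_
      simp only [u, inner_smul_right]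
      rw [real_inner_comm]
      exact mul_le_mul_of_nonneg_left (hf1 y hy).le (by positivity)
    have h2 : ‖w‖⁻¹ * s < ‖x‖ := by
      have := hf2.trans_le (real_inner_le_norm w x)
      rw [inv_mul_lt_iff₀ hw']
      exact this
    have h3 : r ≤ supportFn (K : Set (E n)) u := isMinOn_iff.1 hu₀ u (mem_univ _)
    rw [mem_ball_zero_iff] at hx
    linarith
  exact mem_interior.2 ⟨_, hsub, Metric.isOpen_ball, Metric.mem_ball_self (h u₀)⟩

lemma radialFn_polarSet {K : ConvexBody (E n)} {u : Sph n}
    (h : 0 < supportFn (K : Set (E n)) u) :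
    radialFn (polarSet (K : Set (E n))) u = (supportFn (K : Set (E n)) u)⁻¹ := by
  have : {r : ℝ | 0 ≤ r ∧ r • (u : E n) ∈ polarSet (K : Set (E n))} =
      Icc 0 (supportFn (K : Set (E n)) u)⁻¹ := by
    ext r
    simp only [mem_ofPred_eq, mem_Icc, polarSet, inner_smul_left, and_congr_right_iff,
      RCLike.conj_to_real]
    intro hr
    rcases hr.eq_or_lt with rfl | hr
    · simp [h.le]
    rw [le_inv_comm₀ hr h]
    constructor
    · intro H
      refine supportFn_le fun x hx => ?_
      have := H x hx
      rw [real_inner_comm, mul_comm] at this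
      rwa [← one_div, le_div_iff₀ hr]
    · intro H y hy
      have := (inner_le_supportFn hy u).trans H
      rwa [real_inner_comm, ← one_div, le_div_iff₀ hr, mul_comm] at this
  rw [radialFn, this, csSup_Icc (by positivity)]

lemma radialFn_unitBall (u : Sph n) : radialFn (unitBall n) u = 1 := by
  have : {r : ℝ | 0 ≤ r ∧ r • (u : E n) ∈ unitBall n} = Icc 0 1 := by
    ext r
    simp only [mem_ofPred_eq, mem_Icc, unitBall, mem_closedBall_zero_iff, norm_smul,
      and_congr_right_iff]
    intro hr
    simp [abs_of_nonneg hr]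
  rw [radialFn, this, csSup_Icc zero_le_one]

/-- The unit ball as a convex body. -/
noncomputable def ballBody (n : ℕ) : ConvexBody (E n) :=
  ⟨unitBall n, convex_closedBall _ _, isCompact_closedBall _ _, ⟨0, by simp [unitBall]⟩⟩

lemma coe_ballBody : (ballBody n : Set (E n)) = unitBall n := rfl

lemma supportFn_ballBody (u : Sph n) : supportFn (ballBody n : Set (E n)) u = 1 := by
  refine le_antisymm (supportFn_le fun x hx => ?_) ?_
  · exact (inner_le_norm_sph x u).trans (by simpa [coe_ballBody, unitBall] using hx)
  · have : (u : E n) ∈ (ballBody n : Set (E n)) := by simp [coe_ballBody, unitBall]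
    simpa using inner_le_supportFn this u

lemma ballBody_mem_originInterior (hn : 1 ≤ n) : ballBody n ∈ originInterior n :=
  mem_originInterior_of_supportFn_pos hn fun u => by simp [supportFn_ballBody]

/-! ### Blaschke selection. -/

/-- Blaschke's selection theorem for convex bodies in a fixed ball. -/
lemma exists_subseq_tendsto_of_subset_closedBall (M : ℕ → ConvexBody (E n)) (R : ℝ)
    (hM : ∀ i, (M i : Set (E n)) ⊆ Metric.closedBall 0 R) :
    ∃ (M₀ : ConvexBody (E n)) (ψ : ℕ → ℕ), StrictMono ψ ∧
      Tendsto (fun i => M (ψ i)) atTop (𝓝 M₀) := by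
  let N : ℕ → TopologicalSpace.NonemptyCompacts (E n) := fun i =>
    ⟨⟨M i, (M i).isCompact⟩, (M i).nonempty⟩
  obtain ⟨L, -, ψ, hψ, hL⟩ :=
    (TopologicalSpace.NonemptyCompacts.isCompact_subsets_of_isCompact
      (isCompact_closedBall (0 : E n) R)).tendsto_subseq (x := N) hM
  rw [tendsto_iff_dist_tendsto_zero] at hL
  have hNL : ∀ i, Metric.hausdorffEDist (M i : Set (E n)) (L : Set (E n)) ≠ ⊤ := fun i =>
    Metric.hausdorffEDist_ne_top_of_nonempty_of_bounded (M i).nonempty L.nonempty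
      (M i).isBounded L.isCompact.isBounded
  have hdist : ∀ i, dist (N i) L = Metric.hausdorffDist (M i : Set (E n)) (L : Set (E n)) :=
    fun i => rfl
  -- Move `x`, `y` to nearest points of `M (ψ i)`, combine there, and return to `L`. Each of the two
  -- passages costs one Hausdorff distance, whence the factor 2.
  have hconv : Convex ℝ (L : Set (E n)) := by
    intro x hx y hy a b ha hb hab
    rw [← L.isCompact.isClosed.closure_eq, Metric.mem_closure_iff_infDist_zero L.nonempty]
    refine le_antisymm (le_of_tendsto_of_tendsto' tendsto_const_nhds
      (by simpa using hL.const_mul 2) fun i => ?_) Metric.infDist_nonneg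
    obtain ⟨x', hx', hxx⟩ := (M (ψ i)).isCompact.exists_infDist_eq_dist (M (ψ i)).nonempty x
    obtain ⟨y', hy', hyy⟩ := (M (ψ i)).isCompact.exists_infDist_eq_dist (M (ψ i)).nonempty y
    have hLN : Metric.hausdorffEDist (L : Set (E n)) (M (ψ i) : Set (E n)) ≠ ⊤ := by
      rw [Metric.hausdorffEDist_comm]; exact hNL _
    have h1 := Metric.infDist_le_hausdorffDist_of_mem hx hLN
    have h2 := Metric.infDist_le_hausdorffDist_of_mem hy hLN
    have h3 := Metric.infDist_le_hausdorffDist_of_mem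
      ((M (ψ i)).convex hx' hy' ha hb hab) (hNL (ψ i))
    rw [hxx, Metric.hausdorffDist_comm] at h1
    rw [hyy, Metric.hausdorffDist_comm] at h2
    have h4 : dist (a • x + b • y) (a • x' + b • y') ≤ a * dist x x' + b * dist y y' := by
      refine (dist_add_add_le _ _ _ _).trans ?_
      rw [dist_smul₀, dist_smul₀, Real.norm_of_nonneg ha, Real.norm_of_nonneg hb]
    have h5 := Metric.infDist_le_infDist_add_dist (s := (L : Set (E n))) (x := a • x + b • y)
      (y := a • x' + b • y')
    simp only [hdist]
    have h6 := mul_le_mul_of_nonneg_left h1 ha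
    have h7 := mul_le_mul_of_nonneg_left h2 hb
    have h8 : a * Metric.hausdorffDist (M (ψ i) : Set (E n)) (L : Set (E n)) +
        b * Metric.hausdorffDist (M (ψ i) : Set (E n)) (L : Set (E n)) =
        Metric.hausdorffDist (M (ψ i) : Set (E n)) (L : Set (E n)) := by
      rw [← add_mul, hab, one_mul]
    linarith
  refine ⟨⟨L, hconv, L.isCompact, L.nonempty⟩, ψ, hψ, ?_⟩
  rw [tendsto_iff_dist_tendsto_zero]
  exact hL

/-! ### Divergence of the dual volume integral. -/

/-- A function that is at least `a * 2 ^ (m k)` on sets of measure at least `b / 2 ^ (m k)`,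
for every `k`, has infinite integral. -/
lemma lintegral_eq_top_of_dyadic {α : Type*} [MeasurableSpace α] (ν : Measure α)
    {F : α → ℝ≥0∞} {C : ℕ → Set α} (hC : ∀ k, MeasurableSet (C k)) {m : ℕ} (hm : 1 ≤ m)
    {a b : ℝ≥0∞} (ha : a ≠ 0) (hb : b ≠ 0)
    (hF : ∀ k, ∀ x ∈ C k, a * 2 ^ (m * k) ≤ F x)
    (hCb : ∀ k, b ≤ 2 ^ (m * k) * ν (C k)) : ∫⁻ x, F x ∂ν = ⊤ := by
  have hgeom : ∀ K : ℕ, ∑ k ∈ Finset.range (K + 1), (2 : ℝ≥0∞) ^ (m * k) ≤ 2 * 2 ^ (m * K) := by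
    intro K
    induction K with
    | zero => simp
    | succ K ih =>
      rw [Finset.sum_range_succ, two_mul]
      gcongr
      refine ih.trans ?_
      rw [← pow_succ']
      exact pow_le_pow_right₀ (by norm_num) (by nlinarith)
  -- The largest index `k < K` with `x ∈ C k` dominates the sum up to the factor 2 of the geometric
  -- series, so the sets need not be nested.
  have hpt : ∀ (K : ℕ) (x : α),
      ∑ k ∈ Finset.range K, (C k).indicator (fun _ => a * 2 ^ (m * k)) x ≤ 2 * F x := by
    intro K x
    induction K with
    | zero => simp
    | succ K ih =>
      by_cases hx : x ∈ C K
      · calc ∑ k ∈ Finset.range (K + 1), (C k).indicator (fun _ => a * 2 ^ (m * k)) x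
            ≤ ∑ k ∈ Finset.range (K + 1), a * 2 ^ (m * k) :=
              Finset.sum_le_sum fun k _ => indicator_le_self' (fun _ _ => zero_le) x
          _ = a * ∑ k ∈ Finset.range (K + 1), 2 ^ (m * k) := by rw [Finset.mul_sum]
          _ ≤ a * (2 * 2 ^ (m * K)) := by gcongr; exact hgeom K
          _ = 2 * (a * 2 ^ (m * K)) := by ring
          _ ≤ 2 * F x := by gcongr; exact hF K x hx
      · rw [Finset.sum_range_succ, indicator_of_notMem hx, add_zero]
        exact ih
  have hle : ∀ K : ℕ, (K : ℝ≥0∞) * (a * b) ≤ 2 * ∫⁻ x, F x ∂ν := by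
    intro K
    calc (K : ℝ≥0∞) * (a * b) = ∑ k ∈ Finset.range K, a * b := by simp
      _ ≤ ∑ k ∈ Finset.range K, ∫⁻ x, (C k).indicator (fun _ => a * 2 ^ (m * k)) x ∂ν := by
          refine Finset.sum_le_sum fun k _ => ?_
          rw [lintegral_indicator_const (hC k), mul_assoc]
          gcongr
          exact hCb k
      _ = ∫⁻ x, ∑ k ∈ Finset.range K, (C k).indicator (fun _ => a * 2 ^ (m * k)) x ∂ν := by
          rw [lintegral_finsetSum]
          exact fun k _ => measurable_const.indicator (hC k)
      _ ≤ ∫⁻ x, 2 * F x ∂ν := lintegral_mono (hpt K)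
      _ = 2 * ∫⁻ x, F x ∂ν := lintegral_const_mul' _ _ ENNReal.ofNat_ne_top
  by_contra htop
  obtain ⟨K, hK⟩ := ENNReal.exists_nat_mul_gt (mul_ne_zero ha hb)
    (ENNReal.mul_ne_top (a := 2) ENNReal.ofNat_ne_top htop)
  exact absurd (hle K) (not_le.2 hK)

/-- The open cap of the sphere around `v` of those points of the open hemisphere centred at `v`
whose distance to the line through `v` is less than `ε`. -/
def cap (v : Sph n) (ε : ℝ) : Set (Sph n) :=
  {u | 0 < inner ℝ (u : E n) (v : E n) ∧
    ‖(u : E n) - (inner ℝ (u : E n) (v : E n)) • (v : E n)‖ < ε}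

lemma isOpen_cap (v : Sph n) (ε : ℝ) : IsOpen (cap v ε) := by
  refine IsOpen.and ?_ ?_ <;> exact isOpen_lt (by fun_prop) (by fun_prop)

/-- The map `T` fixes `v` and contracts its orthogonal complement by `ε`, so it scales volume by `ε
^ (n - 1)`. It sends a fixed open set `A` into the cone over the cap, and the cap's measure is `n`
times the volume of that cone. -/
lemma exists_le_sphereMeasure_cap (hn : 1 ≤ n) (v : Sph n) :
    ∃ b : ℝ≥0∞, b ≠ 0 ∧ ∀ ε : ℝ, 0 < ε → ε ≤ 1 →
      ENNReal.ofReal (ε ^ (n - 1)) * b ≤ sphereMeasure n (cap v ε) := by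
  -- Height above 1/4 gives `‖T x‖ > 1/4`, so a transversal part below `ε / 4` drops below `ε` after
  -- normalization. The upper bounds 1/2 and 1/4 keep `‖T x‖ < 1`.
  let A : Set (E n) := {x | (1 / 4 < inner ℝ x (v : E n) ∧ inner ℝ x (v : E n) < 1 / 2) ∧
    ‖x - (inner ℝ x (v : E n)) • (v : E n)‖ < 1 / 4}
  have hAo : IsOpen A := by
    refine IsOpen.and (IsOpen.and ?_ ?_) ?_ <;> exact isOpen_lt (by fun_prop) (by fun_prop)
  have hvv : inner ℝ (v : E n) (v : E n) = 1 := by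
    rw [real_inner_self_eq_norm_sq]; simp
  have hAne : A.Nonempty := by
    refine ⟨(3 / 8 : ℝ) • (v : E n), ⟨?_, ?_⟩, ?_⟩ <;>
      simp only [inner_smul_left, hvv] <;> norm_num
  refine ⟨volume A, (hAo.measure_pos volume hAne).ne', fun ε hε hε1 => ?_⟩
  let f : Module.Dual ℝ (E n) := (ε⁻¹ - 1) • (innerSL ℝ (v : E n)).toLinearMap
  have hf : ∀ x : E n, f x = (ε⁻¹ - 1) * inner ℝ x (v : E n) := fun x => by
    simp [f, real_inner_comm]
  let T : E n →ₗ[ℝ] E n := ε • LinearMap.transvection f (v : E n)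
  have hT : ∀ x, T x = ε • x + ((1 - ε) * inner ℝ x (v : E n)) • (v : E n) := fun x => by
    simp only [T, LinearMap.smul_apply, LinearMap.transvection.apply, hf, smul_add, smul_smul]
    congr 2
    field_simp
  -- The transvection has determinant `1 + f v = ε⁻¹`, and the scalar `ε` contributes `ε ^ n`.
  have hdet : LinearMap.det T = ε ^ (n - 1) := by
    obtain ⟨m, rfl⟩ : ∃ m, n = m + 1 := ⟨n - 1, by omega⟩
    rw [LinearMap.det_smul, LinearMap.transvection.det, hf, hvv]
    simp only [finrank_euclideanSpace, Fintype.card_fin, Nat.add_sub_cancel]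
    rw [pow_succ]
    field_simp
    ring
  have hsub : T '' A ⊆ Ioo (0 : ℝ) 1 • (((↑) : Sph n → E n) '' cap v ε) := by
    rintro _ ⟨x, ⟨⟨hx1, hx2⟩, hx3⟩, rfl⟩
    set s := inner ℝ x (v : E n) with hs
    have hTs : inner ℝ (T x) (v : E n) = s := by
      rw [hT, inner_add_left, inner_smul_left, inner_smul_left, hvv]
      simp only [RCLike.conj_to_real, ← hs]
      ring
    have hTp : T x - s • (v : E n) = ε • (x - s • (v : E n)) := by
      rw [hT, ← hs]
      module
    have hTn : ‖T x - s • (v : E n)‖ < ε * (1 / 4) := by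
      rw [hTp, norm_smul, Real.norm_of_nonneg hε.le]
      gcongr
    have hlow : 1 / 4 < ‖T x‖ := by
      have := inner_le_norm_sph (T x) v
      rw [hTs] at this
      linarith
    have hup : ‖T x‖ < 1 := by
      have h1 : ‖T x‖ ≤ ‖T x - s • (v : E n)‖ + ‖s • (v : E n)‖ := by
        simpa using norm_add_le (T x - s • (v : E n)) (s • (v : E n))
      rw [norm_smul, norm_sph, mul_one, Real.norm_of_nonneg (by linarith)] at h1
      linarith
    have hpos : 0 < ‖T x‖ := by linarith
    refine ⟨‖T x‖, ⟨hpos, hup⟩, ‖T x‖⁻¹ • T x, ⟨⟨‖T x‖⁻¹ • T x, ?_⟩, ⟨?_, ?_⟩, rfl⟩, ?_⟩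
    · simp [norm_smul, hpos.ne']
    · simp only [inner_smul_left, hTs, RCLike.conj_to_real]
      have : 0 < s := by linarith
      positivity
    · simp only [inner_smul_left, hTs, RCLike.conj_to_real, mul_smul, ← smul_sub, norm_smul,
        norm_inv, norm_norm]
      rw [inv_mul_lt_iff₀ hpos]
      nlinarith
    · simp [smul_smul, hpos.ne']
  calc ENNReal.ofReal (ε ^ (n - 1)) * volume A = volume (T '' A) := by
        rw [Measure.addHaar_image_linearMap, hdet, abs_of_pos (by positivity)]
    _ ≤ volume (Ioo (0 : ℝ) 1 • (((↑) : Sph n → E n) '' cap v ε)) := measure_mono hsub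
    _ ≤ (n : ℝ≥0∞) * volume (Ioo (0 : ℝ) 1 • (((↑) : Sph n → E n) '' cap v ε)) :=
        le_mul_of_one_le_left zero_le (by exact_mod_cast hn)
    _ = sphereMeasure n (cap v ε) := by
        rw [sphereMeasure, Measure.toSphere_apply' _ (isOpen_cap v ε).measurableSet]
        simp

/-- If positive functions `h i` converge pointwise to a function that is at most a multiple of
the distance to the line through `v`, then the pointwise lower limit of `G (1 / h i)` has infinite
integral, for `G` of growth at least `t ^ q`, `q ≥ n - 1`. -/
lemma lintegral_liminf_eq_top (hn : 1 ≤ n) {G : ℝ → Sph n → ℝ}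
    (hGtop : ∀ u, Tendsto (fun t => G t u) atTop atTop)
    {q c T : ℝ} (hq : (n : ℝ) - 1 ≤ q) (hc : 0 < c)
    (hGc : ∀ t, T ≤ t → ∀ u, c * t ^ q ≤ G t u)
    {h : ℕ → Sph n → ℝ} (hpos : ∀ i u, 0 < h i u) {h₀ : Sph n → ℝ}
    (hlim : ∀ u, Tendsto (fun i => h i u) atTop (𝓝 (h₀ u))) {v : Sph n} {R : ℝ}
    (hR : ∀ u : Sph n, 0 < inner ℝ (u : E n) (v : E n) →
      h₀ u ≤ R * ‖(u : E n) - (inner ℝ (u : E n) (v : E n)) • (v : E n)‖) :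
    ∫⁻ u, liminf (fun i => ENNReal.ofReal (G (h i u)⁻¹ u)) atTop ∂(sphereMeasure n) = ⊤ := by
  have hlow : ∀ u, ∀ x : ℝ, 0 < x → h₀ u < x⁻¹ → ∀ᶠ i in atTop, x ≤ (h i u)⁻¹ := by
    intro u x hx hux
    filter_upwards [(hlim u).eventually_lt_const hux] with i hi
    rw [le_inv_comm₀ hx (hpos i u)]
    exact hi.le
  obtain ⟨b, hb0, hb⟩ := exists_le_sphereMeasure_cap hn v
  rcases hn.eq_or_lt with rfl | hn2
  -- For `n = 1` the exponent `q` may be 0, so the growth bound gives nothing. Here the distance to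
  -- the line is zero, hence `h₀ ≤ 0` on a cap of positive measure, and `hGtop` makes the integrand
  -- infinite there.
  · have hmain : ∀ u ∈ cap v 1, liminf (fun i => ENNReal.ofReal (G (h i u)⁻¹ u)) atTop = ⊤ := by
      intro u hu
      have hperp : (u : E 1) - (inner ℝ (u : E 1) (v : E 1)) • (v : E 1) = 0 := by
        have hv : (v : E 1) 0 * (v : E 1) 0 = 1 := by
          have := norm_sph v
          rw [EuclideanSpace.norm_eq] at this
          simpa [sq] using this
        ext j
        rw [Subsingleton.elim j 0]
        simp only [PiLp.sub_apply, PiLp.smul_apply, smul_eq_mul, PiLp.inner_apply,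
          PiLp.zero_apply, Fin.sum_univ_one, Fin.isValue, RCLike.inner_apply, conj_trivial]
        linear_combination (-(u : E 1) 0) * hv
      have hle : h₀ u ≤ 0 := by simpa [hperp] using hR u hu.1
      have hz : Tendsto (fun i => (h i u)⁻¹) atTop atTop := by
        refine tendsto_atTop.2 fun x => ?_
        have hx : 0 < max x 1 := by positivity
        filter_upwards [hlow u (max x 1) hx (hle.trans_lt (by positivity))] with i hi
        exact (le_max_left _ _).trans hi
      exact (ENNReal.tendsto_ofReal_atTop.comp ((hGtop u).comp hz)).liminf_eq
    have hcap : sphereMeasure 1 (cap v 1) ≠ 0 := by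
      have := hb 1 one_pos le_rfl
      simp only [one_pow, ENNReal.ofReal_one, one_mul] at this
      exact fun h => hb0 (le_zero_iff.1 (h ▸ this))
    refine top_unique ?_
    calc (⊤ : ℝ≥0∞) = ⊤ * sphereMeasure 1 (cap v 1) := (ENNReal.top_mul hcap).symm
      _ = ∫⁻ u, (cap v 1).indicator (fun _ => ⊤) u ∂(sphereMeasure 1) :=
          (lintegral_indicator_const (isOpen_cap v 1).measurableSet _).symm
      _ ≤ _ := lintegral_mono fun u => by
          by_cases hu : u ∈ cap v 1
          · rw [indicator_of_mem hu, hmain u hu]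
          · simp [hu]
  -- On the cap of radius `(D * 2 ^ k)⁻¹` the integrand is at least `c * 2 ^ ((n - 1) * k)`, while
  -- the cap has measure at least a constant times `2 ^ (-(n - 1) * k)`. The maxima with 1 keep
  -- these radii at most 1 and put the arguments of `G` beyond `T`.
  · set D : ℝ := max R 1 * max T 1 with hD
    have hD1 : 1 ≤ D := one_le_mul_of_one_le_of_one_le (le_max_right _ _) (le_max_right _ _)
    have hDpos : 0 < D := by linarith
    refine lintegral_eq_top_of_dyadic (sphereMeasure n)
      (C := fun k => cap v ((D * 2 ^ k)⁻¹)) (fun k => (isOpen_cap v _).measurableSet)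
      (m := n - 1) (by omega) (a := ENNReal.ofReal c)
      (b := ENNReal.ofReal ((D ^ (n - 1))⁻¹) * b) (by simpa using hc) ?_ ?_ ?_
    · exact mul_ne_zero (by simpa using pow_pos hDpos _) hb0
    · intro k u hu
      set x : ℝ := max T 1 * 2 ^ k with hx
      have h2k : (1 : ℝ) ≤ 2 ^ k := one_le_pow₀ (by norm_num)
      have hT1 : (1 : ℝ) ≤ max T 1 := le_max_right _ _
      have hR1 : (1 : ℝ) ≤ max R 1 := le_max_right _ _
      have hx1 : 2 ^ k ≤ x := le_mul_of_one_le_left (by positivity) hT1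
      have hxT : T ≤ x := (le_max_left T 1).trans (le_mul_of_one_le_right (by positivity) h2k)
      have hxpos : 0 < x := by positivity
      have hux : h₀ u < x⁻¹ := by
        calc h₀ u ≤ R * ‖(u : E n) - (inner ℝ (u : E n) (v : E n)) • (v : E n)‖ := hR u hu.1
          _ ≤ max R 1 * ‖(u : E n) - (inner ℝ (u : E n) (v : E n)) • (v : E n)‖ := by
              gcongr; exact le_max_left _ _
          _ < max R 1 * (D * 2 ^ k)⁻¹ := by
              have := hu.2
              gcongr
          _ = x⁻¹ := by rw [hD, hx]; field_simp
      refine le_liminf_of_le (by isBoundedDefault) ?_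
      filter_upwards [hlow u x hxpos hux] with i hi
      have h1 := hGc _ (hxT.trans hi) u
      have h2 : (2 : ℝ) ^ ((n - 1) * k) ≤ (h i u)⁻¹ ^ q := by
        have hy1 : 1 ≤ (h i u)⁻¹ := (h2k.trans hx1).trans hi
        calc (2 : ℝ) ^ ((n - 1) * k) = (2 ^ k) ^ (n - 1) := by rw [mul_comm, pow_mul]
          _ ≤ ((h i u)⁻¹) ^ (n - 1) := by gcongr; exact hx1.trans hi
          _ = ((h i u)⁻¹) ^ ((n : ℝ) - 1) := by
              rw [← Real.rpow_natCast, Nat.cast_sub hn, Nat.cast_one]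
          _ ≤ _ := Real.rpow_le_rpow_of_exponent_le hy1 hq
      rw [← ENNReal.ofReal_ofNat 2, ← ENNReal.ofReal_pow (by norm_num),
        ← ENNReal.ofReal_mul hc.le]
      exact ENNReal.ofReal_le_ofReal ((mul_le_mul_of_nonneg_left h2 hc.le).trans h1)
    · intro k
      have h2k : (1 : ℝ) ≤ 2 ^ k := one_le_pow₀ (by norm_num)
      have h3 := hb ((D * 2 ^ k)⁻¹) (by positivity)
        (inv_le_one_of_one_le₀ (one_le_mul_of_one_le_of_one_le hD1 h2k))
      calc ENNReal.ofReal ((D ^ (n - 1))⁻¹) * b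
          = 2 ^ ((n - 1) * k) * (ENNReal.ofReal ((D * 2 ^ k)⁻¹ ^ (n - 1)) * b) := by
            rw [← mul_assoc]
            congr 1
            rw [← ENNReal.ofReal_ofNat 2, ← ENNReal.ofReal_pow (by norm_num),
              ← ENNReal.ofReal_mul (by positivity)]
            congr 1
            clear_value D
            rw [mul_comm (n - 1) k, pow_mul, ← inv_pow, ← mul_pow]
            congr 1
            field_simp
        _ ≤ _ := by gcongr

/-! ### Continuity of the objective in the measure and the body. -/

/-- Uniformly convergent functions can be integrated against weakly convergent measures. -/
lemma tendsto_integral_of_tendsto {ι X : Type*} {l : Filter ι} [TopologicalSpace X]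
    [CompactSpace X] [MeasurableSpace X] [OpensMeasurableSpace X] {F : ι → C(X, ℝ)} {F₀ : C(X, ℝ)}
    (hF : Tendsto F l (𝓝 F₀)) {ν : ι → FiniteMeasure X} {ν₀ : FiniteMeasure X}
    (hν : Tendsto ν l (𝓝 ν₀)) :
    Tendsto (fun i => ∫ x, F i x ∂(ν i : Measure X)) l (𝓝 (∫ x, F₀ x ∂(ν₀ : Measure X))) := by
  have hint : ∀ (f : C(X, ℝ)) (i : ι), Integrable f (ν i : Measure X) := fun f i =>
    (BoundedContinuousFunction.mkOfCompact f).integrable _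
  have h1 : Tendsto (fun i => ∫ x, F₀ x ∂(ν i : Measure X)) l
      (𝓝 (∫ x, F₀ x ∂(ν₀ : Measure X))) :=
    FiniteMeasure.tendsto_iff_forall_integral_tendsto.1 hν
      (BoundedContinuousFunction.mkOfCompact F₀)
  have hmass : Tendsto (fun i => ((ν i).mass : ℝ)) l (𝓝 (ν₀.mass : ℝ)) :=
    (NNReal.continuous_coe.tendsto _).comp hν.mass
  have h2 : Tendsto (fun i => ∫ x, F i x ∂(ν i : Measure X) - ∫ x, F₀ x ∂(ν i : Measure X)) l
      (𝓝 0) := by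
    -- Replacing `F₀` by `F i` costs at most the sup distance times the total mass, and the masses
    -- converge.
    refine squeeze_zero_norm (a := fun i => ‖F i - F₀‖ * ((ν i).mass : ℝ)) (fun i => ?_) ?_
    · rw [← integral_sub (hint _ i) (hint _ i)]
      exact norm_integral_le_of_norm_le_const
        (Eventually.of_forall fun x => (F i - F₀).norm_coe_le_norm x)
    · simpa using (tendsto_iff_norm_sub_tendsto_zero.1 hF).mul hmass
  simpa using h2.add h1

/-- The extension by zero of a function on `(0, ∞)`. -/
noncomputable def extendZero (φ : ℝ → ℝ) (t : ℝ) : ℝ := if 0 < t then φ t else 0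

lemma extendZero_of_pos (φ : ℝ → ℝ) {t : ℝ} (ht : 0 < t) : extendZero φ t = φ t := if_pos ht

lemma extendZero_of_nonpos (φ : ℝ → ℝ) {t : ℝ} (ht : t ≤ 0) : extendZero φ t = 0 :=
  if_neg (not_lt.2 ht)

lemma ClassI.extendZero_nonneg {φ : ℝ → ℝ} (hφ : ClassI φ) (t : ℝ) : 0 ≤ extendZero φ t := by
  rcases le_or_gt t 0 with ht | ht
  · rw [extendZero_of_nonpos φ ht]
  · rw [extendZero_of_pos φ ht]; exact (hφ.pos t ht).le

lemma ClassI.monotone_extendZero {φ : ℝ → ℝ} (hφ : ClassI φ) : Monotone (extendZero φ) := by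
  intro s t hst
  rcases le_or_gt s 0 with hs | hs
  · rw [extendZero_of_nonpos φ hs]; exact hφ.extendZero_nonneg t
  · have ht := hs.trans_le hst
    rw [extendZero_of_pos φ hs, extendZero_of_pos φ ht]
    exact hφ.strictMonoOn.monotoneOn hs ht hst

lemma ClassI.continuous_extendZero {φ : ℝ → ℝ} (hφ : ClassI φ) : Continuous (extendZero φ) := by
  refine continuous_iff_continuousAt.2 fun t => ?_
  rcases lt_trichotomy t 0 with ht | rfl | ht
  · refine (continuousAt_const (y := (0 : ℝ))).congr ?_
    filter_upwards [Iio_mem_nhds ht] with s hs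
    exact (extendZero_of_nonpos φ (le_of_lt hs)).symm
  · rw [ContinuousAt, extendZero_of_nonpos φ le_rfl]
    suffices h : Tendsto (extendZero φ) (𝓝[≤] 0 ⊔ 𝓝[>] 0) (𝓝 0) by
      rwa [nhdsLE_sup_nhdsGT] at h
    refine Tendsto.sup ?_ ?_
    · refine tendsto_const_nhds.congr' ?_
      filter_upwards [self_mem_nhdsWithin] with s hs
      exact (extendZero_of_nonpos φ hs).symm
    · refine hφ.tendsto_zero.congr' ?_
      filter_upwards [self_mem_nhdsWithin] with s hs
      exact (extendZero_of_pos φ hs).symm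
  · refine (hφ.continuousOn.continuousAt (Ioi_mem_nhds ht)).congr ?_
    filter_upwards [Ioi_mem_nhds ht] with s hs
    exact (extendZero_of_pos φ hs).symm

lemma objective_eq_integral_extendZero (φ : ℝ → ℝ) (μ : FiniteMeasure (Sph n))
    {Q : ConvexBody (E n)} (hQ : Q ∈ originInterior n) :
    objective φ μ Q = ∫ u, extendZero φ (supportMap Q u) ∂(μ : Measure (Sph n)) :=
  integral_congr_ae (Eventually.of_forall fun u =>
    (extendZero_of_pos φ (supportFn_pos hQ u)).symm)

lemma ClassI.objective_nonneg {φ : ℝ → ℝ} (hφ : ClassI φ) (μ : FiniteMeasure (Sph n))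
    {Q : ConvexBody (E n)} (hQ : Q ∈ originInterior n) : 0 ≤ objective φ μ Q :=
  integral_nonneg fun u => (hφ.pos _ (supportFn_pos hQ u)).le

lemma ClassI.tendsto_objective {φ : ℝ → ℝ} (hφ : ClassI φ) {ι : Type*} {l : Filter ι}
    {μs : ι → FiniteMeasure (Sph n)} {μ : FiniteMeasure (Sph n)} (hμ : Tendsto μs l (𝓝 μ))
    {M : ι → ConvexBody (E n)} (hM : ∀ i, M i ∈ originInterior n) {M₀ : ConvexBody (E n)}
    (hM₀ : M₀ ∈ originInterior n) (hlim : Tendsto M l (𝓝 M₀)) :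
    Tendsto (fun i => objective φ (μs i) (M i)) l (𝓝 (objective φ μ M₀)) := by
  simp_rw [objective_eq_integral_extendZero φ _ (hM _), objective_eq_integral_extendZero φ _ hM₀]
  let Φ : C(ℝ, ℝ) := ⟨extendZero φ, hφ.continuous_extendZero⟩
  exact tendsto_integral_of_tendsto (F := fun i => Φ.comp (supportMap (M i)))
    (F₀ := Φ.comp (supportMap M₀))
    (((ContinuousMap.continuous_postcomp Φ).comp continuous_supportMap).tendsto M₀ |>.comp hlim) hμ

/-! ### Uniform boundedness of minimizers. -/

lemma integrable_continuous (μ : FiniteMeasure (Sph n)) {f : Sph n → ℝ} (hf : Continuous f) :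
    Integrable f (μ : Measure (Sph n)) :=
  (BoundedContinuousFunction.mkOfCompact ⟨f, hf⟩).integrable _

/-- The open hemisphere around `v` has positive measure, since otherwise `μ` is concentrated on the
closed hemisphere around `-v`. Hence so has some set `⟨u, v⟩ > 1 / (k + 1)`, and `φ` is unbounded.
-/
lemma exists_lt_integral_of_not_concentratedOnHemisphere {φ : ℝ → ℝ} (hφ : ClassI φ)
    {μ : FiniteMeasure (Sph n)} (hμ : ¬ ConcentratedOnHemisphere μ) (v : Sph n) (C : ℝ) :
    ∃ L : ℝ, 0 < L ∧
      C < ∫ u, extendZero φ (L * inner ℝ (u : E n) (v : E n)) ∂(μ : Measure (Sph n)) := by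
  have hpos : (μ : Measure (Sph n)) {u : Sph n | 0 < inner ℝ (u : E n) (v : E n)} ≠ 0 := by
    intro h0
    refine hμ ⟨-v, ?_⟩
    convert h0 using 2
    ext u
    simp [inner_neg_right]
  have hun : {u : Sph n | 0 < inner ℝ (u : E n) (v : E n)} =
      ⋃ k : ℕ, {u : Sph n | 1 / ((k : ℝ) + 1) < inner ℝ (u : E n) (v : E n)} := by
    ext u
    simp only [mem_ofPred_eq, mem_iUnion]
    exact ⟨exists_nat_one_div_lt, fun ⟨k, hk⟩ => lt_trans (by positivity) hk⟩
  rw [hun] at hpos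
  obtain ⟨k, hk⟩ := exists_measure_pos_of_not_measure_iUnion_null hpos
  set S : Set (Sph n) := {u : Sph n | 1 / ((k : ℝ) + 1) < inner ℝ (u : E n) (v : E n)} with hS
  have hSo : IsOpen S := isOpen_lt (by fun_prop) (by fun_prop)
  have hm : 0 < (μ : Measure (Sph n)).real S :=
    ENNReal.toReal_pos hk.ne' (measure_ne_top _ _)
  have hδ : (0 : ℝ) < 1 / ((k : ℝ) + 1) := by positivity
  obtain ⟨t, htC, ht0⟩ := ((hφ.tendsto_top.eventually_gt_atTop
    (C / (μ : Measure (Sph n)).real S)).and (eventually_gt_atTop 0)).exists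
  refine ⟨t / (1 / ((k : ℝ) + 1)), by positivity, ?_⟩
  rw [div_lt_iff₀ hm] at htC
  refine htC.trans_le ?_
  calc φ t * (μ : Measure (Sph n)).real S
      = ∫ u, S.indicator (fun _ => φ t) u ∂(μ : Measure (Sph n)) := by
        rw [integral_indicator_const _ hSo.measurableSet, smul_eq_mul, mul_comm]
    _ ≤ _ := by
        refine integral_mono ((integrable_const _).indicator hSo.measurableSet)
          (integrable_continuous μ (hφ.continuous_extendZero.comp (by fun_prop))) fun u => ?_
        by_cases hu : u ∈ S
        · rw [indicator_of_mem hu, ← extendZero_of_pos φ ht0]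
          refine hφ.monotone_extendZero ?_
          rw [div_mul_eq_mul_div, le_div_iff₀ hδ]
          exact mul_le_mul_of_nonneg_left (le_of_lt hu) ht0.le
        · rw [indicator_of_notMem hu]
          exact hφ.extendZero_nonneg _

/-- The bound holds for `(i, v)` near `(∞, v₀)` by joint convergence. Compactness of the sphere
leaves finitely many neighbourhoods, and monotonicity in `L` allows taking the largest of their
constants. -/
lemma exists_eventually_lt_integral {φ : ℝ → ℝ} (hφ : ClassI φ)
    {μ : FiniteMeasure (Sph n)} (hμ : ¬ ConcentratedOnHemisphere μ)
    {μs : ℕ → FiniteMeasure (Sph n)} (hlim : Tendsto μs atTop (𝓝 μ)) (C : ℝ) :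
    ∃ L : ℝ, 0 < L ∧ ∀ᶠ i in atTop, ∀ v : Sph n,
      C < ∫ u, extendZero φ (L * inner ℝ (u : E n) (v : E n)) ∂(μs i : Measure (Sph n)) := by
  have hmono : ∀ (ν : FiniteMeasure (Sph n)) (v : Sph n) {L L' : ℝ}, 0 < L → L ≤ L' →
      ∫ u, extendZero φ (L * inner ℝ (u : E n) (v : E n)) ∂(ν : Measure (Sph n)) ≤
      ∫ u, extendZero φ (L' * inner ℝ (u : E n) (v : E n)) ∂(ν : Measure (Sph n)) := by
    intro ν v L L' hL hLL
    refine integral_mono (integrable_continuous ν (hφ.continuous_extendZero.comp (by fun_prop)))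
      (integrable_continuous ν (hφ.continuous_extendZero.comp (by fun_prop))) fun u => ?_
    rcases le_or_gt (inner ℝ (u : E n) (v : E n)) 0 with h | h
    · simp only
      rw [extendZero_of_nonpos φ (mul_nonpos_of_nonneg_of_nonpos hL.le h)]
      exact hφ.extendZero_nonneg _
    · exact hφ.monotone_extendZero (mul_le_mul_of_nonneg_right hLL h.le)
  suffices H : ∃ L : ℝ, 0 < L ∧ ∀ᶠ i in atTop, ∀ v ∈ (univ : Set (Sph n)),
      C < ∫ u, extendZero φ (L * inner ℝ (u : E n) (v : E n)) ∂(μs i : Measure (Sph n)) by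
    simpa using H
  refine isCompact_univ.induction_on (p := fun s : Set (Sph n) => ∃ L : ℝ, 0 < L ∧ ∀ᶠ i in atTop, ∀ v ∈ s,
      C < ∫ u, extendZero φ (L * inner ℝ (u : E n) (v : E n)) ∂(μs i : Measure (Sph n)))
    ⟨1, one_pos, by simp⟩ ?_ ?_ ?_
  · rintro s t hst ⟨L, hL, h⟩
    exact ⟨L, hL, h.mono fun i hi v hv => hi v (hst hv)⟩
  · rintro s t ⟨L, hL, h⟩ ⟨L', hL', h'⟩
    refine ⟨max L L', lt_max_of_lt_left hL, ?_⟩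
    filter_upwards [h, h'] with i hi hi' v hv
    rcases hv with hv | hv
    · exact (hi v hv).trans_le (hmono _ v hL (le_max_left _ _))
    · exact (hi' v hv).trans_le (hmono _ v hL' (le_max_right _ _))
  · intro v₀ _
    obtain ⟨L, hL, hLC⟩ := exists_lt_integral_of_not_concentratedOnHemisphere hφ hμ v₀ C
    -- Currying turns joint continuity into uniform convergence in `u` as `v → v₀`, as needed
    -- against varying measures.
    let K : C(Sph n, C(Sph n, ℝ)) := ContinuousMap.curry
      ⟨fun p : Sph n × Sph n => extendZero φ (L * inner ℝ (p.2 : E n) (p.1 : E n)),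
        hφ.continuous_extendZero.comp (by fun_prop)⟩
    have hK := tendsto_integral_of_tendsto (l := atTop ×ˢ 𝓝 v₀)
      (F := fun p : ℕ × Sph n => K p.2) (F₀ := K v₀) (ν := fun p => μs p.1)
      ((K.continuous.tendsto v₀).comp tendsto_snd) (hlim.comp tendsto_fst)
    obtain ⟨pa, ha, pb, hb, hab⟩ := eventually_prod_iff.1 (hK.eventually_const_lt hLC)
    refine ⟨{v | pb v}, mem_nhdsWithin_of_mem_nhds hb, L, hL, ?_⟩
    filter_upwards [ha] with i hi v hv
    exact hab hi hv

/-- Bodies whose objective does not exceed that of the ball are uniformly bounded. -/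
lemma exists_eventually_subset_closedBall (hn : 1 ≤ n) {φ : ℝ → ℝ} (hφ : ClassI φ)
    {μ : FiniteMeasure (Sph n)} (hμ : ¬ ConcentratedOnHemisphere μ)
    {μs : ℕ → FiniteMeasure (Sph n)} (hlim : Tendsto μs atTop (𝓝 μ))
    {M : ℕ → ConvexBody (E n)} (hM : ∀ i, M i ∈ originInterior n)
    (hle : ∀ i, objective φ (μs i) (M i) ≤ objective φ (μs i) (ballBody n)) :
    ∃ R : ℝ, ∀ᶠ i in atTop, (M i : Set (E n)) ⊆ Metric.closedBall 0 R := by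
  have hball := hφ.tendsto_objective hlim (fun _ => ballBody_mem_originInterior hn)
    (ballBody_mem_originInterior hn) tendsto_const_nhds
  obtain ⟨L, hL, hev⟩ := exists_eventually_lt_integral hφ hμ hlim (objective φ μ (ballBody n) + 1)
  refine ⟨L, ?_⟩
  filter_upwards [hev, hball.eventually_lt_const (lt_add_one _)] with i hi hi' x hx
  by_contra hxL
  rw [mem_closedBall_zero_iff, not_le] at hxL
  have hx0 : 0 < ‖x‖ := hL.trans hxL
  -- The segment from the origin to `x` lies in `M i`, so `h(u)` is at least `‖x‖` times the
  -- positive part of `⟨u, v⟩`.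
  let v : Sph n := ⟨‖x‖⁻¹ • x, by simp [norm_smul, hx0.ne']⟩
  refine absurd ((hi v).trans_le ?_) (not_lt.2 ((hle i).trans hi'.le))
  rw [objective_eq_integral_extendZero φ _ (hM i)]
  refine integral_mono (integrable_continuous _ (hφ.continuous_extendZero.comp (by fun_prop)))
    (integrable_continuous _ (hφ.continuous_extendZero.comp (supportMap (M i)).continuous))
    fun u => ?_
  rcases le_or_gt (inner ℝ (u : E n) (v : E n)) 0 with h | h
  · simp only
    rw [extendZero_of_nonpos φ (mul_nonpos_of_nonneg_of_nonpos hL.le h)]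
    exact hφ.extendZero_nonneg _
  · refine hφ.monotone_extendZero ?_
    calc L * inner ℝ (u : E n) (v : E n) ≤ ‖x‖ * inner ℝ (u : E n) (v : E n) := by gcongr
      _ = inner ℝ x (u : E n) := by
          simp only [v, inner_smul_right]
          rw [mul_inv_cancel_left₀ hx0.ne', real_inner_comm]
      _ ≤ _ := inner_le_supportFn hx u

/-! ### Closedness of the constraint set. -/

instance : IsFiniteMeasure (sphereMeasure n) := by
  unfold sphereMeasure; infer_instance

instance : (sphereMeasure n).IsOpenPosMeasure := by
  unfold sphereMeasure; infer_instance

lemma integrable_sphereMeasure {f : Sph n → ℝ} (hf : Continuous f) :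
    Integrable f (sphereMeasure n) :=
  (BoundedContinuousFunction.mkOfCompact ⟨f, hf⟩).integrable _

lemma nonempty_sph (hn : 1 ≤ n) : Nonempty (Sph n) :=
  have : Nonempty (Fin n) := ⟨⟨0, hn⟩⟩
  (NormedSpace.sphere_nonempty.2 zero_le_one).to_subtype

lemma ClassGI.continuous_comp {G : ℝ → Sph n → ℝ} (hG : ClassGI G) {X : Type*}
    [TopologicalSpace X] {f : X → ℝ} {g : X → Sph n} (hf : Continuous f) (hg : Continuous g)
    (hpos : ∀ x, 0 < f x) : Continuous fun x => G (f x) (g x) :=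
  hG.continuousOn.comp_continuous (f := fun x => (f x, g x)) (hf.prodMk hg)
    fun x => ⟨hpos x, mem_univ _⟩

lemma continuous_inv_supportFn {Q : ConvexBody (E n)} (hQ : Q ∈ originInterior n) :
    Continuous fun u => (supportFn (Q : Set (E n)) u)⁻¹ :=
  (continuous_supportFn Q).inv₀ fun u => (supportFn_pos hQ u).ne'

lemma dualVolume_polarSet (G : ℝ → Sph n → ℝ) {Q : ConvexBody (E n)}
    (hQ : Q ∈ originInterior n) : dualVolume G (polarSet (Q : Set (E n))) =
      ∫ u, G (supportFn (Q : Set (E n)) u)⁻¹ u ∂(sphereMeasure n) := by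
  simp_rw [dualVolume, radialFn_polarSet (supportFn_pos hQ _)]

lemma dualVolume_unitBall (G : ℝ → Sph n → ℝ) :
    dualVolume G (unitBall n) = ∫ u, G 1 u ∂(sphereMeasure n) := by
  simp_rw [dualVolume, radialFn_unitBall]

lemma ballBody_mem_constraintTilde (hn : 1 ≤ n) (G : ℝ → Sph n → ℝ) :
    ballBody n ∈ constraintTilde G := by
  have h := ballBody_mem_originInterior hn
  refine ⟨h, ?_⟩
  rw [dualVolume_polarSet G h, dualVolume_unitBall]
  simp_rw [supportFn_ballBody, inv_one]

lemma tendsto_supportFn {M : ℕ → ConvexBody (E n)} {M₀ : ConvexBody (E n)}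
    (hlim : Tendsto M atTop (𝓝 M₀)) (u : Sph n) :
    Tendsto (fun i => supportFn (M i : Set (E n)) u) atTop
      (𝓝 (supportFn (M₀ : Set (E n)) u)) :=
  ((continuous_eval_const (F := C(Sph n, ℝ)) u).comp continuous_supportMap).tendsto M₀ |>.comp hlim

/-- At a direction where the support function vanishes, it is controlled by the distance to the
line through that direction. -/
lemma supportFn_le_mul_norm_sub {K : ConvexBody (E n)} {v : Sph n}
    (hv : supportFn (K : Set (E n)) v ≤ 0) {R : ℝ} (hR : ∀ x ∈ (K : Set (E n)), ‖x‖ ≤ R)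
    {u : Sph n} (hu : 0 < inner ℝ (u : E n) (v : E n)) :
    supportFn (K : Set (E n)) u ≤
      R * ‖(u : E n) - (inner ℝ (u : E n) (v : E n)) • (v : E n)‖ := by
  refine supportFn_le fun x hx => ?_
  set s := inner ℝ (u : E n) (v : E n)
  have h1 : s * inner ℝ x (v : E n) ≤ 0 :=
    mul_nonpos_of_nonneg_of_nonpos hu.le ((inner_le_supportFn hx v).trans hv)
  have h2 : inner ℝ x ((u : E n) - s • (v : E n)) ≤ R * ‖(u : E n) - s • (v : E n)‖ :=
    (real_inner_le_norm _ _).trans (mul_le_mul_of_nonneg_right (hR x hx) (norm_nonneg _))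
  rw [inner_sub_right, inner_smul_right] at h2
  linarith

/-- A limit of bodies in the constraint set has the origin in its interior. -/
lemma mem_originInterior_of_tendsto (hn : 1 ≤ n) {G : ℝ → Sph n → ℝ} (hG : ClassGI G)
    {q c T : ℝ} (hq : (n : ℝ) - 1 ≤ q) (hc : 0 < c)
    (hGc : ∀ t, T ≤ t → ∀ u, c * t ^ q ≤ G t u)
    {M : ℕ → ConvexBody (E n)} (hM : ∀ i, M i ∈ constraintTilde G) {M₀ : ConvexBody (E n)}
    (hlim : Tendsto M atTop (𝓝 M₀)) : M₀ ∈ originInterior n := by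
  refine mem_originInterior_of_supportFn_pos hn fun v => ?_
  by_contra! hv
  obtain ⟨R, hR⟩ := M₀.isBounded.exists_norm_le
  have htop := lintegral_liminf_eq_top hn hG.tendsto_top hq hc hGc
    (fun i u => supportFn_pos (hM i).1 u) (tendsto_supportFn hlim)
    fun u hu => supportFn_le_mul_norm_sub hv hR hu
  have hcont : ∀ i, Continuous fun u => G (supportFn (M i : Set (E n)) u)⁻¹ u := fun i =>
    hG.continuous_comp (continuous_inv_supportFn (hM i).1) continuous_id
      fun u => inv_pos.2 (supportFn_pos (hM i).1 u)
  -- Fatou: the integrals all equal the finite dual volume of the ball, yet the lower limit of the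
  -- integrands has infinite integral.
  have hle := lintegral_liminf_le (μ := sphereMeasure n) (u := atTop)
    (fun i => (hcont i).measurable.ennreal_ofReal)
  have heq : ∀ i, ∫⁻ u, ENNReal.ofReal (G (supportFn (M i : Set (E n)) u)⁻¹ u)
      ∂(sphereMeasure n) = ENNReal.ofReal (dualVolume G (unitBall n)) := fun i => by
    rw [← (hM i).2, dualVolume_polarSet G (hM i).1,
      ofReal_integral_eq_lintegral_ofReal (integrable_sphereMeasure (hcont i))]
    exact Eventually.of_forall fun u => (hG.pos _ (inv_pos.2 (supportFn_pos (hM i).1 u)) u).le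
  simp_rw [heq, liminf_const] at hle
  rw [htop] at hle
  exact ENNReal.ofReal_ne_top (top_unique hle)

lemma mem_constraintTilde_of_tendsto (hn : 1 ≤ n) {G : ℝ → Sph n → ℝ} (hG : ClassGI G)
    {q c T : ℝ} (hq : (n : ℝ) - 1 ≤ q) (hc : 0 < c)
    (hGc : ∀ t, T ≤ t → ∀ u, c * t ^ q ≤ G t u)
    {M : ℕ → ConvexBody (E n)} (hM : ∀ i, M i ∈ constraintTilde G) {M₀ : ConvexBody (E n)}
    (hlim : Tendsto M atTop (𝓝 M₀)) : M₀ ∈ constraintTilde G := by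
  have hM₀ := mem_originInterior_of_tendsto hn hG hq hc hGc hM hlim
  refine ⟨hM₀, ?_⟩
  have := nonempty_sph hn
  have hp := supportFn_pos hM₀
  obtain ⟨u₀, -, hu₀⟩ := isCompact_univ.exists_isMinOn univ_nonempty
    (continuous_supportFn M₀).continuousOn
  set r := supportFn (M₀ : Set (E n)) u₀ with hr
  have hrpos : 0 < r := hp u₀
  -- Once the limit has the origin in its interior, this bound gives the dominating function `G (r /
  -- 2)⁻¹`.
  have hev : ∀ᶠ i in atTop, ∀ u, r / 2 ≤ supportFn (M i : Set (E n)) u := by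
    filter_upwards [Metric.tendsto_nhds.1 hlim (r / 2) (by positivity)] with i hi u
    have h1 := supportFn_le_add_dist M₀ (M i) u
    rw [dist_comm] at h1
    have h2 : r ≤ supportFn (M₀ : Set (E n)) u := isMinOn_iff.1 hu₀ u (mem_univ _)
    linarith
  have hcont : ∀ {Q : ConvexBody (E n)}, Q ∈ originInterior n →
      Continuous fun u => G (supportFn (Q : Set (E n)) u)⁻¹ u := fun hQ =>
    hG.continuous_comp (continuous_inv_supportFn hQ) continuous_id
      fun u => inv_pos.2 (supportFn_pos hQ u)
  have hconv : Tendsto (fun i => ∫ u, G (supportFn (M i : Set (E n)) u)⁻¹ u ∂(sphereMeasure n))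
      atTop (𝓝 (∫ u, G (supportFn (M₀ : Set (E n)) u)⁻¹ u ∂(sphereMeasure n))) := by
    refine tendsto_integral_filter_of_dominated_convergence (fun u => G (r / 2)⁻¹ u)
      (Eventually.of_forall fun i => (hcont (hM i).1).aestronglyMeasurable) ?_
      (integrable_sphereMeasure (hG.continuous_comp continuous_const continuous_id
        fun _ => by positivity)) (Eventually.of_forall fun u => ?_)
    · filter_upwards [hev] with i hi
      refine Eventually.of_forall fun u => ?_
      have hpi := inv_pos.2 (supportFn_pos (hM i).1 u)
      rw [Real.norm_of_nonneg (hG.pos _ hpi u).le]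
      exact (hG.strictMono u).monotoneOn hpi (mem_Ioi.2 (by positivity))
        (inv_anti₀ (by positivity) (hi u))
    · have hat : ContinuousAt (fun t => G t u) (supportFn (M₀ : Set (E n)) u)⁻¹ := by
        refine ContinuousOn.continuousAt (s := Ioi 0) ?_ (Ioi_mem_nhds (inv_pos.2 (hp u)))
        exact hG.continuousOn.comp (by fun_prop : ContinuousOn (fun t : ℝ => (t, u)) (Ioi 0))
          fun t ht => ⟨ht, mem_univ _⟩
      exact hat.tendsto.comp ((tendsto_supportFn hlim u).inv₀ (hp u).ne')
  simp_rw [← dualVolume_polarSet G (hM _).1, (hM _).2, ← dualVolume_polarSet G hM₀] at hconv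
  exact tendsto_nhds_unique hconv tendsto_const_nhds

/-! ### Passage to the limit in the minimization problem. -/

lemma ClassI.bddBelow_objective_image {φ : ℝ → ℝ} (hφ : ClassI φ) (μ : FiniteMeasure (Sph n))
    (G : ℝ → Sph n → ℝ) : BddBelow (objective φ μ '' constraintTilde G) :=
  ⟨0, by rintro _ ⟨Q, hQ, rfl⟩; exact hφ.objective_nonneg μ hQ.1⟩

lemma exists_isSolution_tendsto_subseq (hn : 1 ≤ n) {φ : ℝ → ℝ} (hφ : ClassI φ)
    {μ : FiniteMeasure (Sph n)} (hμ : ¬ ConcentratedOnHemisphere μ)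
    {μs : ℕ → FiniteMeasure (Sph n)} (hlim : Tendsto μs atTop (𝓝 μ))
    {G : ℝ → Sph n → ℝ} (hG : ClassGI G) {q c T : ℝ} (hq : (n : ℝ) - 1 ≤ q) (hc : 0 < c)
    (hGc : ∀ t, T ≤ t → ∀ u, c * t ^ q ≤ G t u) {M : ℕ → ConvexBody (E n)}
    (hM : ∀ i, IsSolution φ (μs i) (constraintTilde G) (M i)) :
    ∃ (M₀ : ConvexBody (E n)) (ms : ℕ → ℕ), IsSolution φ μ (constraintTilde G) M₀ ∧
      Tendsto (fun i => objective φ (μs (ms i)) (M (ms i))) atTop (𝓝 (objective φ μ M₀)) := by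
  have hmin : ∀ i, ∀ Q ∈ constraintTilde G, objective φ (μs i) (M i) ≤ objective φ (μs i) Q :=
    fun i Q hQ => (hM i).2.trans_le
      (csInf_le (hφ.bddBelow_objective_image _ G) (mem_image_of_mem _ hQ))
  obtain ⟨R, hR⟩ := exists_eventually_subset_closedBall hn hφ hμ hlim (fun i => (hM i).1.1)
    fun i => hmin i _ (ballBody_mem_constraintTilde hn G)
  obtain ⟨N, hN⟩ := eventually_atTop.1 hR
  obtain ⟨M₀, ψ, hψ, hconv⟩ := exists_subseq_tendsto_of_subset_closedBall
    (fun i => M (i + N)) R fun i => hN _ (Nat.le_add_left _ _)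
  have hms : Tendsto (fun i => ψ i + N) atTop atTop :=
    (tendsto_add_atTop_nat N).comp hψ.tendsto_atTop
  have hM₀ := mem_constraintTilde_of_tendsto hn hG hq hc hGc (fun i => (hM (ψ i + N)).1) hconv
  have hobj := hφ.tendsto_objective (hlim.comp hms) (fun i => (hM (ψ i + N)).1.1) hM₀.1 hconv
  refine ⟨M₀, fun i => ψ i + N, ⟨hM₀, le_antisymm ?_ ?_⟩, hobj⟩
  · refine le_csInf ⟨_, mem_image_of_mem _ hM₀⟩ ?_
    rintro _ ⟨Q, hQ, rfl⟩
    exact le_of_tendsto_of_tendsto' hobj (hφ.tendsto_objective (hlim.comp hms)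
      (fun _ => hQ.1) hQ.1 tendsto_const_nhds) fun i => hmin _ Q hQ
  · exact csInf_le (hφ.bddBelow_objective_image _ G) (mem_image_of_mem _ hM₀)

theorem exists_isSolution_constraintTilde (hn : 1 ≤ n) {φ : ℝ → ℝ} (hφ : ClassI φ)
    {μ : FiniteMeasure (Sph n)} (hμ : ¬ ConcentratedOnHemisphere μ)
    {μs : ℕ → FiniteMeasure (Sph n)} (hlim : Tendsto μs atTop (𝓝 μ))
    {G : ℝ → Sph n → ℝ} (hG : ClassGI G) {q c T : ℝ} (hq : (n : ℝ) - 1 ≤ q) (hc : 0 < c)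
    (hGc : ∀ t, T ≤ t → ∀ u, c * t ^ q ≤ G t u) {M : ℕ → ConvexBody (E n)}
    (hM : ∀ i, IsSolution φ (μs i) (constraintTilde G) (M i)) :
    ∃ M₀ : ConvexBody (E n), IsSolution φ μ (constraintTilde G) M₀ ∧
      Tendsto (fun i => objective φ (μs i) (M i)) atTop (𝓝 (objective φ μ M₀)) := by
  obtain ⟨M₀, -, hM₀, -⟩ := exists_isSolution_tendsto_subseq hn hφ hμ hlim hG hq hc hGc hM
  refine ⟨M₀, hM₀, tendsto_of_subseq_tendsto fun ns hns => ?_⟩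
  obtain ⟨M₁, ms, hM₁, hconv⟩ := exists_isSolution_tendsto_subseq hn hφ hμ (hlim.comp hns) hG
    hq hc hGc fun i => hM (ns i)
  refine ⟨ms, ?_⟩
  -- Different subsequences may have different limit bodies, but both attain the same infimum.
  rw [hM₀.2, ← hM₁.2]
  exact hconv

/-! ### Reduction of the homogeneous problem to the first one. -/

lemma GrowthCondition.exists_pos_mul_rpow_le {G : ℝ → Sph n → ℝ} (hG : ClassGI G) {q : ℝ}
    (h : GrowthCondition G q) : ∃ c : ℝ, 0 < c ∧ ∀ t, 1 ≤ t → ∀ u, c * t ^ q ≤ G t u := by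
  refine ⟨_, h, fun t ht u => ?_⟩
  have ht0 : 0 < t := by linarith
  rw [← le_div_iff₀ (by positivity)]
  refine csInf_le ⟨0, ?_⟩ ⟨t, u, ht, rfl⟩
  rintro _ ⟨s, w, hs, rfl⟩
  have hs0 : 0 < s := by linarith
  exact div_nonneg (hG.pos s hs0 w).le (by positivity)

lemma ClassGI.comp_mul {G : ℝ → Sph n → ℝ} (hG : ClassGI G) {s : ℝ} (hs : 0 < s) :
    ClassGI fun t u => G (t * s) u where
  continuousOn := hG.continuousOn.comp
    (by fun_prop : ContinuousOn (fun p : ℝ × Sph n => (p.1 * s, p.2)) (Ioi 0 ×ˢ univ))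
    fun p hp => ⟨mul_pos hp.1 hs, mem_univ _⟩
  pos t ht u := hG.pos _ (mul_pos ht hs) u
  strictMono u a ha b hb hab := hG.strictMono u (mul_pos ha hs) (mul_pos hb hs)
    (mul_lt_mul_of_pos_right hab hs)
  tendsto_zero u := by
    refine (hG.tendsto_zero u).comp (tendsto_nhdsWithin_iff.2 ⟨?_, ?_⟩)
    · have : Tendsto (fun t : ℝ => t * s) (𝓝 0) (𝓝 (0 * s)) :=
        (continuous_mul_const s).tendsto 0
      rw [zero_mul] at this
      exact this.mono_left nhdsWithin_le_nhds
    · filter_upwards [self_mem_nhdsWithin] with t ht using mul_pos ht hs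
  tendsto_top u := (hG.tendsto_top u).comp (tendsto_id.atTop_mul_const hs)

lemma ClassGI.integral_strictMonoOn (hn : 1 ≤ n) {G : ℝ → Sph n → ℝ} (hG : ClassGI G)
    {f : Sph n → ℝ} (hf : Continuous f) (hpos : ∀ u, 0 < f u) :
    StrictMonoOn (fun s => ∫ u, G (f u * s) u ∂(sphereMeasure n)) (Ioi 0) := by
  intro s hs t ht hst
  have hc : ∀ {s : ℝ}, 0 < s → Continuous fun u => G (f u * s) u := fun hs =>
    hG.continuous_comp (hf.mul continuous_const) continuous_id fun u => mul_pos (hpos u) hs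
  have hlt : ∀ u, G (f u * s) u < G (f u * t) u := fun u =>
    hG.strictMono u (mul_pos (hpos u) hs) (mul_pos (hpos u) ht)
      (mul_lt_mul_of_pos_left hst (hpos u))
  obtain ⟨u₀⟩ := nonempty_sph hn
  have h := integral_pos_of_integrable_nonneg_nonzero (μ := sphereMeasure n) (x := u₀)
    ((hc ht).sub (hc hs)) (integrable_sphereMeasure ((hc ht).sub (hc hs)))
    (fun u => (sub_pos.2 (hlt u)).le) (sub_pos.2 (hlt u₀)).ne'
  simp only [Pi.sub_apply] at h
  rw [integral_sub (integrable_sphereMeasure (hc ht)) (integrable_sphereMeasure (hc hs))] at h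
  exact sub_pos.1 h

/-- Intermediate value theorem in `x`, with `s = exp x` so that the parameter ranges over all of
`ℝ`. Dominated convergence handles `x → -∞`, Fatou `x → ∞`. -/
lemma ClassGI.exists_integral_eq_one (hn : 1 ≤ n) {G : ℝ → Sph n → ℝ} (hG : ClassGI G)
    {f : Sph n → ℝ} (hf : Continuous f) (hpos : ∀ u, 0 < f u) :
    ∃ s : ℝ, 0 < s ∧ ∫ u, G (f u * s) u ∂(sphereMeasure n) = 1 := by
  have hc : ∀ {s : ℝ}, 0 < s → Continuous fun u => G (f u * s) u := fun hs =>
    hG.continuous_comp (hf.mul continuous_const) continuous_id fun u => mul_pos (hpos u) hs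
  have hcont : Continuous fun x : ℝ => ∫ u, G (f u * Real.exp x) u ∂(sphereMeasure n) := by
    have := continuous_parametric_integral_of_continuous (μ := sphereMeasure n)
      (f := fun (x : ℝ) (u : Sph n) => G (f u * Real.exp x) u)
      (hG.continuous_comp (f := fun p : ℝ × Sph n => f p.2 * Real.exp p.1)
        (by fun_prop) continuous_snd fun p => mul_pos (hpos _) (Real.exp_pos _))
      (isCompact_univ (X := Sph n))
    simpa using this
  have hsmall : ∃ x : ℝ, ∫ u, G (f u * Real.exp x) u ∂(sphereMeasure n) ≤ 1 := by
    have hlim : Tendsto (fun k : ℕ => ∫ u, G (f u * Real.exp (-k)) u ∂(sphereMeasure n)) atTop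
        (𝓝 (∫ _, 0 ∂(sphereMeasure n))) := by
      refine tendsto_integral_of_dominated_convergence (fun u => G (f u * 1) u)
        (fun k => (hc (Real.exp_pos _)).aestronglyMeasurable)
        (integrable_sphereMeasure (hc one_pos)) (fun k => Eventually.of_forall fun u => ?_)
        (Eventually.of_forall fun u => ?_)
      · have hp := mul_pos (hpos u) (Real.exp_pos (-k))
        rw [Real.norm_of_nonneg (hG.pos _ hp u).le]
        refine (hG.strictMono u).monotoneOn hp (mul_pos (hpos u) one_pos)
          (mul_le_mul_of_nonneg_left ?_ (hpos u).le)
        simp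
      · refine (hG.tendsto_zero u).comp (tendsto_nhdsWithin_iff.2
          ⟨?_, Eventually.of_forall fun k => mul_pos (hpos u) (Real.exp_pos _)⟩)
        have h0 : Tendsto (fun k : ℕ => Real.exp (-k)) atTop (𝓝 0) :=
          Real.tendsto_exp_neg_atTop_nhds_zero.comp tendsto_natCast_atTop_atTop
        simpa using h0.const_mul (f u)
    rw [integral_zero] at hlim
    obtain ⟨k, hk⟩ := (hlim.eventually_lt_const one_pos).exists
    exact ⟨_, hk.le⟩
  have hlarge : ∃ x : ℝ, 1 ≤ ∫ u, G (f u * Real.exp x) u ∂(sphereMeasure n) := by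
    by_contra! hlt
    have hle := lintegral_liminf_le (μ := sphereMeasure n) (u := atTop)
      (f := fun (k : ℕ) u => ENNReal.ofReal (G (f u * Real.exp k) u))
      (fun k => (hc (Real.exp_pos _)).measurable.ennreal_ofReal)
    have htop : ∀ u, liminf (fun k : ℕ => ENNReal.ofReal (G (f u * Real.exp k) u)) atTop = ⊤ :=
      fun u => (ENNReal.tendsto_ofReal_atTop.comp ((hG.tendsto_top u).comp
        ((Real.tendsto_exp_atTop.comp tendsto_natCast_atTop_atTop).const_mul_atTop
          (hpos u)))).liminf_eq
    have hone : liminf (fun k : ℕ => ∫⁻ u, ENNReal.ofReal (G (f u * Real.exp k) u)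
        ∂(sphereMeasure n)) atTop ≤ 1 := by
      refine (liminf_le_liminf (Eventually.of_forall fun k => ?_)).trans_eq
        (liminf_const (f := (atTop : Filter ℕ)) 1)
      rw [← ofReal_integral_eq_lintegral_ofReal (integrable_sphereMeasure (hc (Real.exp_pos _)))
        (Eventually.of_forall fun u => (hG.pos _ (mul_pos (hpos u) (Real.exp_pos _)) u).le)]
      simpa using (hlt k).le
    have := nonempty_sph hn
    have hne : sphereMeasure n univ ≠ 0 := (isOpen_univ.measure_pos _ univ_nonempty).ne'
    simp_rw [htop, lintegral_const, ENNReal.top_mul hne] at hle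
    exact absurd (hle.trans hone) (by simp)
  obtain ⟨x, hx⟩ := mem_range_of_exists_le_of_exists_ge hcont hsmall hlarge
  exact ⟨Real.exp x, Real.exp_pos x, hx⟩

/-- The integral is strictly decreasing in the divisor, so the admissible divisors form exactly `[η,
∞)`. -/
lemma homDualVolume_eq_of_integral_eq_one (hn : 1 ≤ n) {G : ℝ → Sph n → ℝ} (hG : ClassGI G)
    {K : Set (E n)} (hK : Continuous (radialFn K)) (hpos : ∀ u, 0 < radialFn K u) {η : ℝ}
    (hη : 0 < η) (h : ∫ u, G (radialFn K u / η) u ∂(sphereMeasure n) = 1) :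
    homDualVolume G K = η := by
  have hset : {s : ℝ | 0 < s ∧ ∫ u, G (radialFn K u / s) u ∂(sphereMeasure n) ≤ 1} = Ici η := by
    ext s
    simp only [mem_ofPred_eq, mem_Ici]
    have hiff : 0 < s → (∫ u, G (radialFn K u / s) u ∂(sphereMeasure n) ≤ 1 ↔ η ≤ s) := by
      intro hs
      have hle := ((hG.integral_strictMonoOn hn hK hpos).le_iff_le (inv_pos.2 hs)
        (inv_pos.2 hη)).trans (inv_le_inv₀ hs hη)
      simp only [← div_eq_mul_inv] at hle
      rwa [h] at hle
    exact ⟨fun ⟨hs, hle⟩ => (hiff hs).1 hle, fun hs =>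
      ⟨hη.trans_le hs, (hiff (hη.trans_le hs)).2 hs⟩⟩
  rw [homDualVolume, hset, csInf_Ici]

lemma exists_integral_eq_one_and_homDualVolume_eq (hn : 1 ≤ n) {G : ℝ → Sph n → ℝ}
    (hG : ClassGI G) {K : Set (E n)} (hK : Continuous (radialFn K))
    (hpos : ∀ u, 0 < radialFn K u) :
    ∃ η : ℝ, 0 < η ∧ ∫ u, G (radialFn K u / η) u ∂(sphereMeasure n) = 1 ∧
      homDualVolume G K = η := by
  obtain ⟨s, hs, h⟩ := hG.exists_integral_eq_one hn hK hpos
  have h' : ∫ u, G (radialFn K u / s⁻¹) u ∂(sphereMeasure n) = 1 := by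
    simpa only [div_inv_eq_mul] using h
  exact ⟨s⁻¹, inv_pos.2 hs, h',
    homDualVolume_eq_of_integral_eq_one hn hG hK hpos (inv_pos.2 hs) h'⟩

/-- The homogeneous constraint set is a constraint set for a rescaled `G`. -/
lemma exists_constraintHat_eq_constraintTilde (hn : 1 ≤ n) {G : ℝ → Sph n → ℝ}
    (hG : ClassGI G) :
    ∃ s : ℝ, 0 < s ∧ constraintHat G = constraintTilde fun t u => G (t * s) u := by
  have hballr : radialFn (unitBall n) = fun _ => 1 := funext radialFn_unitBall
  have hballc : Continuous (radialFn (unitBall n)) := hballr ▸ continuous_const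
  -- With `η` the homogeneous dual volume of the ball, both constraints say that the integral of `G
  -- (ρ_{Q°} / η)` is 1.
  obtain ⟨η, hη, h1, h2⟩ := exists_integral_eq_one_and_homDualVolume_eq hn hG hballc
    fun u => by simp [hballr]
  have hball : dualVolume (fun t u => G (t * η⁻¹) u) (unitBall n) = 1 := by
    simpa only [dualVolume, div_eq_mul_inv] using h1
  refine ⟨η⁻¹, inv_pos.2 hη, ?_⟩
  ext Q
  refine and_congr_right fun hQ => ?_
  have hr : radialFn (polarSet (Q : Set (E n))) = fun u => (supportFn (Q : Set (E n)) u)⁻¹ :=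
    funext fun u => radialFn_polarSet (supportFn_pos hQ u)
  have hc : Continuous (radialFn (polarSet (Q : Set (E n)))) :=
    hr ▸ continuous_inv_supportFn hQ
  have hp : ∀ u, 0 < radialFn (polarSet (Q : Set (E n))) u := fun u => by
    rw [hr]; exact inv_pos.2 (supportFn_pos hQ u)
  rw [h2, hball]
  simp only [dualVolume, ← div_eq_mul_inv]
  constructor
  · intro h
    obtain ⟨η', -, h3, h4⟩ := exists_integral_eq_one_and_homDualVolume_eq hn hG hc hp
    rw [← h, h4, h3]
  · exact homDualVolume_eq_of_integral_eq_one hn hG hc hp hη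

end DualPolar

theorem mainTheorem3 (n : ℕ) (hn : 1 ≤ n)
    (μ : FiniteMeasure (DualPolar.Sph n)) (μs : ℕ → FiniteMeasure (DualPolar.Sph n))
    (hμ : ¬ DualPolar.ConcentratedOnHemisphere μ)
    (hμs : ∀ i, ¬ DualPolar.ConcentratedOnHemisphere (μs i))
    (hlim : Tendsto μs atTop (𝓝 μ))
    (G : ℝ → DualPolar.Sph n → ℝ) (hG : DualPolar.ClassGI G)
    (hgrowth : ∃ q : ℝ, (n : ℝ) - 1 ≤ q ∧ DualPolar.GrowthCondition G q)
    (φ : ℝ → ℝ) (hφ : DualPolar.ClassI φ) :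
    (∀ M : ℕ → ConvexBody (DualPolar.E n),
      (∀ i, DualPolar.IsSolution φ (μs i) (DualPolar.constraintTilde G) (M i)) →
      ∃ M₀ : ConvexBody (DualPolar.E n),
        DualPolar.IsSolution φ μ (DualPolar.constraintTilde G) M₀ ∧
        Tendsto (fun i => DualPolar.objective φ (μs i) (M i)) atTop
          (𝓝 (DualPolar.objective φ μ M₀))) ∧
    (∀ M : ℕ → ConvexBody (DualPolar.E n),
      (∀ i, DualPolar.IsSolution φ (μs i) (DualPolar.constraintHat G) (M i)) →
      ∃ M₀ : ConvexBody (DualPolar.E n),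
        DualPolar.IsSolution φ μ (DualPolar.constraintHat G) M₀ ∧
        Tendsto (fun i => DualPolar.objective φ (μs i) (M i)) atTop
          (𝓝 (DualPolar.objective φ μ M₀))) := by
  obtain ⟨q, hq, hgr⟩ := hgrowth
  obtain ⟨c, hc, hGc⟩ := hgr.exists_pos_mul_rpow_le hG
  obtain ⟨s, hs, hhat⟩ := DualPolar.exists_constraintHat_eq_constraintTilde hn hG
  refine ⟨fun M hM => DualPolar.exists_isSolution_constraintTilde hn hφ hμ hlim hG hq hc hGc hM,
    fun M hM => ?_⟩
  rw [hhat] at hM ⊢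
  -- For `t ≥ s⁻¹` the growth bound applies at `t * s` and yields the constant `c * s ^ q`. The
  -- maximum with 0 only records `t ≥ 0` for `Real.mul_rpow`.
  refine DualPolar.exists_isSolution_constraintTilde hn hφ hμ hlim (hG.comp_mul hs) hq
    (c := c * s ^ q) (T := max s⁻¹ 0) (by positivity) (fun t ht u => ?_) hM
  have h1 : 1 ≤ t * s := (inv_le_iff_one_le_mul₀ hs).1 ((le_max_left _ _).trans ht)
  have h2 := hGc _ h1 u
  rw [Real.mul_rpow ((le_max_right _ _).trans ht) hs.le] at h2
  linarith
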